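/- Let $R$ be an integral domain with field of fractions $K$, and let $R'$ be the integral closure of $R$ in $K$. Call an ideal $I$ of $R$ stable if it is projective as a module over its endomorphism ring $\operatorname{End}_R(I)$, and call $R$ finitely stable if each nonzero finitely generated ideal of $R$ is stable. A domain $D$ is Archimedean if $\bigcap_{n\ge 0} r^nD=(0)$ for each nonunit $r\in D$, and $R$ is locally Archimedean if the localization $R_M$ is Archimedean for each maximal ideal $M$ of $R$. The domain $R$ has finite character if each nonzero element of $R$ belongs to only finitely many maximal ideals of $R$, and is semilocal if it has only finitely many maximal ideals. Assume that $R$ is Archimedean and finitely stable. 1. If $R$ has finite character and $R'$ has only finitely many height-one prime ideals, then $R$ is locally Archimedean. 2. In particular, if $R$ is semilocal, then $R$ is locally Archimedean. -/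

import Mathlib

/-- An ideal is *stable* if it is projective as a module over its endomorphism ring. -/
def IsStableIdeal {R : Type*} [CommRing R] (I : Ideal R) : Prop :=
  Module.Projective (Module.End R I) I

/-- A domain is *finitely stable* if each nonzero finitely generated ideal is stable. -/
def IsFinitelyStable (R : Type*) [CommRing R] [IsDomain R] : Prop :=
  ∀ I : Ideal R, I ≠ ⊥ → I.FG → IsStableIdeal I

/-- A domain `R` is *Archimedean* if the intersection of the ideals `r ^ n R` is zero for each
nonunit `r`. -/
def IsArchimedeanDomain (R : Type*) [CommRing R] [IsDomain R] : Prop :=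
  ∀ r : R, ¬ IsUnit r → ⨅ n : ℕ, Ideal.span {r ^ n} = ⊥

/-- A domain is *locally Archimedean* if its localization at each maximal ideal is Archimedean. -/
def IsLocallyArchimedean (R : Type*) [CommRing R] [IsDomain R] : Prop :=
  ∀ (M : Ideal R) [M.IsMaximal], IsArchimedeanDomain (Localization.AtPrime M)

/-- A domain has *finite character* if each nonzero element belongs to only finitely many
maximal ideals. -/
def HasFiniteCharacter (R : Type*) [CommRing R] [IsDomain R] : Prop :=
  ∀ r : R, r ≠ 0 → {M : Ideal R | M.IsMaximal ∧ r ∈ M}.Finite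

/-- A ring is *semilocal* if it has only finitely many maximal ideals. -/
def IsSemilocal (R : Type*) [CommRing R] : Prop :=
  {M : Ideal R | M.IsMaximal}.Finite

/-- The set of height-one prime ideals of the integral closure of the domain `R` in its
field of fractions. -/
def heightOnePrimesOfIntegralClosure (R : Type*) [CommRing R] [IsDomain R] :
    Set (Ideal (integralClosure R (FractionRing R))) :=
  {Q | Q.IsPrime ∧ Q.height = 1}

/-!
Let `S` be the integral closure of `R` in its field of fractions `K`. Finite stability enters only
through pairs of elements: the dual basis lemma (`IsStableIdeal.exists_sum_eq_one`) gives, for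
`x`, `y` in `K` not both zero, elements `u`, `v` of `K` with `u x + v y = 1` such that `u x`, `u y`,
`v x`, `v y` are multipliers of `R x + R y`, hence lie in `S`. Three facts follow.

* `S` is a Prüfer domain (`IsFinitelyStable.exists_notMem_dvd_mul`).
* Each `z` in `S` satisfies a relation `z² = r z + s` over `R` (`IsFinitelyStable.exists_sq_eq`).
* At most two maximal ideals of `S` lie over a maximal ideal of `R`
  (`IsFinitelyStable.not_three_maximal_over`).

Suppose that `R` has finite character, that `S` has finitely many primes of height one, and that
`R_M` is not Archimedean. No prime `Q` of height one of `S` lies over `M`, since `S_Q` is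
Archimedean and dominates `R_M` in that case. By prime avoidance there is `c ≠ 0` in `M` outside all
primes of height one of `S`. A maximal ideal of `S` containing `c` then contains a nonzero prime
without `c` (`Ideal.exists_isPrime_le_notMem`). Only finitely many maximal ideals of `S` contain
`c`, so some nonzero `x` in `R` lies in all these primes, and since `S` is Prüfer, `x` is divisible
in `S` by all powers of `c` (`pow_dvd_of_forall_maximal`). Quadratic integrality brings this down
to `R`: if `x = a z` with `z² = r z + s`, then `x² = a (r x + a s)`. So `x²` is divisible in `R` by
all powers of the nonunit `c`, against the Archimedean property of `R`.

If `R` is semilocal, so is `S`, and each maximal ideal of the Prüfer domain `S` contains at most one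
prime of height one.
-/

/-! ### Stable ideals and multiplier rings -/

/-- The ring of multipliers `(J : J)` of an `R`-submodule `J` of an `R`-algebra `A`. For a nonzero
ideal of a domain and its field of fractions it is the endomorphism ring of the ideal. -/
def Submodule.multiplierSubalgebra {R A : Type*} [CommRing R] [CommRing A] [Algebra R A]
    (J : Submodule R A) : Subalgebra R A where
  carrier := {e | ∀ z ∈ J, e * z ∈ J}
  mul_mem' {a b} ha hb z hz := by rw [mul_assoc]; exact ha _ (hb z hz)
  add_mem' {a b} ha hb z hz := by rw [add_mul]; exact J.add_mem (ha z hz) (hb z hz)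
  algebraMap_mem' r z hz := by rw [← Algebra.smul_def]; exact J.smul_mem r hz

theorem Submodule.mem_multiplierSubalgebra {R A : Type*} [CommRing R] [CommRing A] [Algebra R A]
    {J : Submodule R A} {e : A} : e ∈ J.multiplierSubalgebra ↔ ∀ z ∈ J, e * z ∈ J := Iff.rfl

/-- The dual basis lemma: a nonzero stable ideal `I` is invertible over its ring of multipliers.
The elements `i` of `s` generate `I` over that ring, and the `q i` are dual to them. -/
theorem IsStableIdeal.exists_sum_eq_one {R K : Type*} [CommRing R] [IsDomain R] [Field K]
    [Algebra R K] [IsFractionRing R K] {I : Ideal R} (hI : IsStableIdeal I) (h0 : I ≠ ⊥) :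
    ∃ (s : Finset I) (q : I → K),
      (∑ i ∈ s, q i * algebraMap R K i = 1) ∧ ∀ i, ∀ x ∈ I,
        q i * algebraMap R K x ∈ (Submodule.map (Algebra.linearMap R K) I).multiplierSubalgebra := by
  obtain ⟨σ, hσ⟩ := Module.projective_def.1 hI
  obtain ⟨a, ha, ha0⟩ := Submodule.exists_mem_ne_zero_of_ne_bot h0
  have haK : algebraMap R K a ≠ 0 := by simpa using ha0
  -- `R` is commutative, so scalars from `R` come out of the coordinates of the section `σ`.
  have key : ∀ (x y : I) (i : I), (x : R) • σ y i = (y : R) • σ x i := by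
    intro x y i
    have h : ∀ (r : R) (z : I), σ (r • z) i = r • σ z i := by
      intro r z
      have := σ.map_smul (algebraMap R (Module.End R I) r) z
      rw [Module.End.smul_def, Module.algebraMap_end_apply] at this
      rw [this, Finsupp.smul_apply, smul_eq_mul, ← Algebra.smul_def]
    rw [← h, ← h]
    congr 2
    ext
    simp [mul_comm]
  have key2 : ∀ (f : Module.End R I) (x y : I), (x : R) * (f y : R) = y * (f x : R) := by
    intro f x y
    have h : (x : R) • f y = (y : R) • f x := by
      rw [← map_smul, ← map_smul]
      congr 1
      ext
      simp [mul_comm]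
    simpa using congrArg (Subtype.val) h
  refine ⟨(σ ⟨a, ha⟩).support,
    fun i ↦ algebraMap R K (σ ⟨a, ha⟩ i ⟨a, ha⟩ : I) / (algebraMap R K a) ^ 2, ?_, ?_⟩
  · have h := congrArg (fun z : I ↦ algebraMap R K z) (hσ ⟨a, ha⟩)
    simp only [Finsupp.linearCombination_apply, Finsupp.sum, id, Module.End.smul_def,
      AddSubmonoidClass.coe_finsetSum, map_sum] at h
    have h2 : ∀ i : I, algebraMap R K (σ ⟨a, ha⟩ i ⟨a, ha⟩ : I) / (algebraMap R K a) ^ 2 *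
        algebraMap R K i = algebraMap R K (σ ⟨a, ha⟩ i i : I) / algebraMap R K a := by
      intro i
      have := congrArg (algebraMap R K) (key2 (σ ⟨a, ha⟩ i) ⟨a, ha⟩ i)
      simp only [map_mul] at this
      field_simp
      rw [this]; ring
    rw [Finset.sum_congr rfl fun i _ ↦ h2 i, ← Finset.sum_div, h, div_self haK]
  · rintro i x hx _ ⟨z, hz, rfl⟩
    refine ⟨(σ ⟨x, hx⟩ i ⟨z, hz⟩ : I), (σ ⟨x, hx⟩ i ⟨z, hz⟩).2, ?_⟩
    have h1 := congrArg (algebraMap R K) (key2 (σ ⟨a, ha⟩ i) ⟨a, ha⟩ ⟨z, hz⟩)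
    have h2 := congrArg (fun f : Module.End R I ↦ algebraMap R K (f ⟨z, hz⟩ : I))
      (key ⟨a, ha⟩ ⟨x, hx⟩ i)
    simp only [LinearMap.smul_apply, Submodule.coe_smul, smul_eq_mul, map_mul] at h1 h2
    simp only [Algebra.linearMap_apply]
    field_simp
    linear_combination (algebraMap R K a) * h2 + algebraMap R K x * h1

/-- The submodule `R x + R y` of the field of fractions of a finitely stable domain is invertible
over its ring of multipliers, with `u` and `v` in its inverse. -/
theorem IsFinitelyStable.exists_mul_add_mul_eq_one {R K : Type*} [CommRing R] [IsDomain R]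
    [Field K] [Algebra R K] [IsFractionRing R K] (hS : IsFinitelyStable R) (x y : K)
    (h0 : x ≠ 0 ∨ y ≠ 0) :
    ∃ u v : K, u * x + v * y = 1 ∧ ∀ w ∈ ({u, v} : Set K), ∀ z ∈ ({x, y} : Set K),
      w * z ∈ (Submodule.span R {x, y}).multiplierSubalgebra := by
  obtain ⟨p, s, hs, rfl⟩ := IsFractionRing.div_surjective (A := R) x
  obtain ⟨q, t, ht, rfl⟩ := IsFractionRing.div_surjective (A := R) y
  have hs0 : algebraMap R K s ≠ 0 := by simpa using nonZeroDivisors.ne_zero hs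
  have ht0 : algebraMap R K t ≠ 0 := by simpa using nonZeroDivisors.ne_zero ht
  set c : K := algebraMap R K s * algebraMap R K t with hc
  have hc0 : c ≠ 0 := mul_ne_zero hs0 ht0
  set x := algebraMap R K p / algebraMap R K s
  set y := algebraMap R K q / algebraMap R K t
  have hx : algebraMap R K (p * t) = c * x := by simp only [x, hc, map_mul]; field_simp
  have hy : algebraMap R K (q * s) = c * y := by simp only [y, hc, map_mul]; field_simp
  set I : Ideal R := Ideal.span {p * t, q * s} with hI
  have hIJ : Submodule.map (Algebra.linearMap R K) I = Submodule.span R {c * x, c * y} := by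
    rw [hI, Ideal.span, Submodule.map_span, Set.image_pair, Algebra.linearMap_apply,
      Algebra.linearMap_apply, hx, hy]
  have hI0 : I ≠ ⊥ := by
    intro h
    rw [hI, Ideal.span_eq_bot] at h
    rcases h0 with h0 | h0
    · exact mul_ne_zero hc0 h0 (by rw [← hx, h (p * t) (by simp), map_zero])
    · exact mul_ne_zero hc0 h0 (by rw [← hy, h (q * s) (by simp), map_zero])
  have hE : (Submodule.map (Algebra.linearMap R K) I).multiplierSubalgebra =
      (Submodule.span R {x, y}).multiplierSubalgebra := by
    have hmem : ∀ z, c * z ∈ Submodule.span R {c * x, c * y} ↔ z ∈ Submodule.span R {x, y} := by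
      intro z
      simp only [Submodule.mem_span_pair]
      refine exists_congr fun a ↦ exists_congr fun b ↦ ?_
      rw [← mul_right_inj' hc0 (b := a • x + b • y), mul_add, mul_smul_comm, mul_smul_comm]
    ext e
    rw [hIJ, Submodule.mem_multiplierSubalgebra, Submodule.mem_multiplierSubalgebra]
    constructor
    · intro h z hz
      rw [← hmem, mul_left_comm]
      exact h _ ((hmem z).2 hz)
    · intro h z hz
      obtain ⟨z, rfl⟩ : ∃ z', z = c * z' := ⟨z / c, by field_simp⟩
      rw [mul_left_comm, hmem]
      exact h _ ((hmem z).1 hz)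
  obtain ⟨S, f, hf1, hf⟩ := (hS I hI0 (Submodule.fg_span (Set.toFinite _))
    |>.exists_sum_eq_one (K := K) hI0)
  have hyI : ∀ i : I, ∃ m n : R, algebraMap R K i =
      algebraMap R K m * (c * x) + algebraMap R K n * (c * y) := by
    rintro ⟨i, hi⟩
    obtain ⟨m, n, h⟩ := Ideal.mem_span_pair.1 hi
    exact ⟨m, n, by rw [← hx, ← hy, ← map_mul, ← map_mul, ← map_add, h]⟩
  choose m n hmn using hyI
  have hsum : ∀ (g : I → R) (z : R), z ∈ I → (∑ i ∈ S, f i * algebraMap R K (g i)) *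
      algebraMap R K z ∈ (Submodule.span R {x, y}).multiplierSubalgebra := by
    intro g z hz
    rw [Finset.sum_mul, ← hE]
    refine sum_mem fun i _ ↦ ?_
    rw [mul_right_comm]
    exact mul_mem (hf i z hz) (Subalgebra.algebraMap_mem _ _)
  have hpI : p * t ∈ I := Ideal.subset_span (by simp)
  have hqI : q * s ∈ I := Ideal.subset_span (by simp)
  refine ⟨c * ∑ i ∈ S, f i * algebraMap R K (m i), c * ∑ i ∈ S, f i * algebraMap R K (n i),
    ?_, ?_⟩
  · rw [← hf1, Finset.mul_sum, Finset.mul_sum, Finset.sum_mul, Finset.sum_mul,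
      ← Finset.sum_add_distrib]
    refine Finset.sum_congr rfl fun i _ ↦ ?_
    rw [hmn i]; ring
  · have h1 := fun g ↦ hsum g _ hpI
    have h2 := fun g ↦ hsum g _ hqI
    simp only [hx, hy] at h1 h2
    rintro w (rfl | rfl) z (rfl | rfl) <;> rw [mul_comm c, mul_assoc]
    exacts [h1 _, h2 _, h1 _, h2 _]

theorem Submodule.isIntegral_of_mem_multiplierSubalgebra {R A : Type*} [CommRing R] [CommRing A]
    [IsDomain A] [Algebra R A] {J : Submodule R A} (h0 : J ≠ ⊥) (hJ : J.FG) {e : A}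
    (he : e ∈ J.multiplierSubalgebra) : IsIntegral R e :=
  isIntegral_of_smul_mem_submodule J h0 hJ e he

/-- If an integral element `x` has a unimodular relation `u + v * x = 1` with `u`, `v` in the
conductor of `x` into a subring, then `x` lies in that subring: the conductor ideal generates the
unit ideal in an integral extension, so it is the unit ideal. -/
theorem Subalgebra.mem_of_add_mul_eq_one {R A : Type*} [CommRing R] [CommRing A]
    [Algebra R A] (E : Subalgebra R A) {x u v : A} (hx : IsIntegral R x) (huv : u + v * x = 1)
    (hux : u * x ∈ E) (hv : v ∈ E) (hvx : v * x ∈ E) : x ∈ E := by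
  obtain ⟨p, hp, hpx⟩ := hx
  set n := p.natDegree
  have h1 : ∀ k, x - (v * x) ^ k * x ∈ E := by
    intro k
    induction k with
    | zero => simp
    | succ k ih =>
      have : x - (v * x) ^ (k + 1) * x = (x - (v * x) ^ k * x) + (v * x) ^ k * (u * x) := by
        linear_combination -(v * x) ^ k * x * huv
      rw [this]
      exact add_mem ih (mul_mem (pow_mem hvx k) hux)
  have h2 : (v * x) ^ n * x ∈ E := by
    have h3 : x ^ n = -∑ i ∈ Finset.range n, algebraMap R A (p.coeff i) * x ^ i := by
      rw [Polynomial.eval₂_eq_sum_range, Finset.sum_range_succ, hp.coeff_natDegree, map_one,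
        one_mul] at hpx
      linear_combination hpx
    have h4 : (v * x) ^ n * x = -∑ i ∈ Finset.range n, algebraMap R A (p.coeff i) *
        ((v * x) ^ (i + 1) * v ^ (n - (i + 1))) := by
      have : (v * x) ^ n * x = v ^ n * x * x ^ n := by ring
      rw [this, h3, mul_neg, Finset.mul_sum]
      congr 1
      refine Finset.sum_congr rfl fun i hi ↦ ?_
      obtain ⟨k, hk⟩ := Nat.exists_eq_add_of_lt (Finset.mem_range.1 hi)
      have : n - (i + 1) = k := by omega
      rw [this, hk]
      ring
    rw [h4]
    exact neg_mem (sum_mem fun i _ ↦ mul_mem (E.algebraMap_mem _)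
      (mul_mem (pow_mem hvx _) (pow_mem hv _)))
  simpa using add_mem (h1 n) h2

/-! ### The integral closure of a finitely stable domain -/

section IntegralClosure

variable {R S : Type*} [CommRing R] [IsDomain R] [CommRing S] [Algebra R S]

/-- `IsFinitelyStable.exists_mul_add_mul_eq_one` for elements of the integral closure `S`. Here
`e₁₁ = u x`, `e₁₂ = u y`, `e₂₁ = v x`, `e₂₂ = v y`, where `u x + v y = 1`. -/
theorem IsFinitelyStable.exists_unimodular (K : Type*) [Field K] [Algebra R K]
    [IsFractionRing R K] [Algebra S K] [IsScalarTower R S K] [IsIntegralClosure S R K]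
    (hS : IsFinitelyStable R) (x y : S) (h0 : x ≠ 0 ∨ y ≠ 0) :
    ∃ e₁₁ e₁₂ e₂₁ e₂₂ : S, e₁₁ + e₂₂ = 1 ∧ e₁₁ * y = e₁₂ * x ∧ e₂₂ * x = e₂₁ * y ∧
      ∀ e ∈ ({e₁₁, e₂₂} : Set S), ∀ z ∈ ({x, y} : Set S), ∃ a b : R,
        e * z = algebraMap R S a * x + algebraMap R S b * y := by
  have hinj := IsIntegralClosure.algebraMap_injective S R K
  have h0' : algebraMap S K x ≠ 0 ∨ algebraMap S K y ≠ 0 := by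
    simpa only [ne_eq, map_eq_zero_iff _ hinj] using h0
  obtain ⟨u, v, huv, hE⟩ := hS.exists_mul_add_mul_eq_one _ _ h0'
  set J := Submodule.span R {algebraMap S K x, algebraMap S K y} with hJ
  have hJ0 : J ≠ ⊥ := by
    intro h
    rw [hJ, Submodule.span_eq_bot] at h
    rcases h0' with h' | h'
    · exact h' (h _ (by simp))
    · exact h' (h _ (by simp))
  have hlift : ∀ w ∈ ({u, v} : Set K), ∀ z ∈ ({algebraMap S K x, algebraMap S K y} : Set K),
      ∃ e : S, algebraMap S K e = w * z := fun w hw z hz ↦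
    IsIntegralClosure.isIntegral_iff.1
      (Submodule.isIntegral_of_mem_multiplierSubalgebra hJ0
        (Submodule.fg_span (Set.toFinite _)) (hE w hw z hz))
  obtain ⟨e₁₁, h₁₁⟩ := hlift u (by simp) (algebraMap S K x) (by simp)
  obtain ⟨e₁₂, h₁₂⟩ := hlift u (by simp) (algebraMap S K y) (by simp)
  obtain ⟨e₂₁, h₂₁⟩ := hlift v (by simp) (algebraMap S K x) (by simp)
  obtain ⟨e₂₂, h₂₂⟩ := hlift v (by simp) (algebraMap S K y) (by simp)
  refine ⟨e₁₁, e₁₂, e₂₁, e₂₂, hinj ?_, hinj ?_, hinj ?_, ?_⟩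
  · rw [map_add, h₁₁, h₂₂, huv, map_one]
  · rw [map_mul, map_mul, h₁₁, h₁₂]; ring
  · rw [map_mul, map_mul, h₂₂, h₂₁]; ring
  · intro e he z hz
    have he' : algebraMap S K e ∈ J.multiplierSubalgebra := by
      rcases he with rfl | rfl
      · rw [h₁₁]; exact hE _ (by simp) _ (by simp)
      · rw [h₂₂]; exact hE _ (by simp) _ (by simp)
    have hz' : algebraMap S K z ∈ J := by
      rcases hz with rfl | rfl <;> exact Submodule.subset_span (by simp)
    obtain ⟨a, b, hab⟩ := Submodule.mem_span_pair.1 (he' _ hz')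
    refine ⟨a, b, hinj ?_⟩
    rw [map_mul, ← hab, map_add, map_mul, map_mul, ← IsScalarTower.algebraMap_apply,
      ← IsScalarTower.algebraMap_apply, Algebra.smul_def, Algebra.smul_def]

/-- The integral closure of a finitely stable domain is a Prüfer domain: divisibility is total
after localization at a prime ideal. -/
theorem IsFinitelyStable.exists_notMem_dvd_mul (K : Type*) [Field K] [Algebra R K]
    [IsFractionRing R K] [Algebra S K] [IsScalarTower R S K] [IsIntegralClosure S R K]
    (hS : IsFinitelyStable R) (N : Ideal S) [N.IsPrime] (x y : S) :
    ∃ s ∉ N, x ∣ s * y ∨ y ∣ s * x := by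
  by_cases h0 : x ≠ 0 ∨ y ≠ 0
  · obtain ⟨e₁₁, e₁₂, e₂₁, e₂₂, h1, h2, h3, -⟩ := hS.exists_unimodular K x y h0
    by_cases h : e₁₁ ∈ N
    · refine ⟨e₂₂, fun h' ↦ ?_, Or.inr ⟨e₂₁, by rw [h3, mul_comm]⟩⟩
      exact (Ideal.ne_top_iff_one N).1 ‹N.IsPrime›.ne_top (h1 ▸ N.add_mem h h')
    · exact ⟨e₁₁, h, Or.inl ⟨e₁₂, by rw [h2, mul_comm]⟩⟩
  · push Not at h0
    exact ⟨1, (Ideal.ne_top_iff_one N).1 ‹N.IsPrime›.ne_top, Or.inl (by simp [h0.2])⟩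

/-- The integral closure of a finitely stable domain `R` is a quadratic extension of `R`:
`R + R x` is its own ring of multipliers for each integral `x`. -/
theorem IsFinitelyStable.exists_sq_eq (K : Type*) [Field K] [Algebra R K]
    [IsFractionRing R K] [Algebra S K] [IsScalarTower R S K] [IsIntegralClosure S R K]
    (hS : IsFinitelyStable R) (x : S) :
    ∃ r s : R, x ^ 2 = algebraMap R S r * x + algebraMap R S s := by
  have hinj := IsIntegralClosure.algebraMap_injective S R K
  obtain ⟨u, v, huv, hE⟩ := hS.exists_mul_add_mul_eq_one (1 : K) (algebraMap S K x)
    (Or.inl one_ne_zero)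
  have hux := hE u (by simp) (algebraMap S K x) (by simp)
  have hv := hE v (by simp) 1 (by simp)
  have hvx := hE v (by simp) (algebraMap S K x) (by simp)
  rw [mul_one] at hv huv
  have hx := Subalgebra.mem_of_add_mul_eq_one _
    (IsIntegralClosure.isIntegral_iff (A := S) |>.2 ⟨x, rfl⟩) huv hux hv hvx
  obtain ⟨s, r, h⟩ := Submodule.mem_span_pair.1 (hx (algebraMap S K x)
    (Submodule.subset_span (by simp)))
  refine ⟨r, s, hinj ?_⟩
  rw [map_pow, sq, ← h, map_add, map_mul, ← IsScalarTower.algebraMap_apply,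
    ← IsScalarTower.algebraMap_apply, Algebra.smul_def, Algebra.smul_def, mul_one, add_comm]

/-- At most two maximal ideals of the integral closure `S` lie over a maximal ideal of a finitely
stable domain. Given three of them, choose `x ∈ N₂ \ (N₁ ∪ N₃)` and `y ∈ N₁ \ (N₂ ∪ N₃)`. The
multipliers of `R x + R y` have the same residue modulo each of the three ideals, and the relation
`u x + v y = 1`, with `u x ∈ N₂` and `v y ∈ N₁`, is impossible. -/
theorem IsFinitelyStable.not_three_maximal_over (K : Type*) [Field K] [Algebra R K]
    [IsFractionRing R K] [Algebra S K] [IsScalarTower R S K] [IsIntegralClosure S R K]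
    (hS : IsFinitelyStable R) {M : Ideal R} {N₁ N₂ N₃ : Ideal S}
    (h₁ : N₁.IsMaximal) (h₂ : N₂.IsMaximal) (h₃ : N₃.IsMaximal)
    (hM₁ : N₁.comap (algebraMap R S) = M) (hM₂ : N₂.comap (algebraMap R S) = M)
    (hM₃ : N₃.comap (algebraMap R S) = M) (h₁₂ : N₁ ≠ N₂) (h₁₃ : N₁ ≠ N₃) : N₂ = N₃ := by
  by_contra h₂₃
  have hle : ∀ {I J : Ideal S}, I.IsMaximal → J.IsMaximal → I ≠ J → ¬ I ≤ J :=
    fun hI hJ hne h ↦ hne (hI.eq_of_le hJ.ne_top h)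
  obtain ⟨x, hx₂, hx⟩ := Set.not_subset.1 (mt Ideal.subset_union.1
    (not_or.2 ⟨hle h₂ h₁ h₁₂.symm, hle h₂ h₃ h₂₃⟩))
  obtain ⟨y, hy₁, hy⟩ := Set.not_subset.1 (mt Ideal.subset_union.1
    (not_or.2 ⟨hle h₁ h₂ h₁₂, hle h₁ h₃ h₁₃⟩))
  simp only [Set.mem_union, SetLike.mem_coe, not_or] at hx hy hx₂ hy₁
  obtain ⟨hx₁, hx₃⟩ := hx
  obtain ⟨hy₂, hy₃⟩ := hy
  have hx0 : x ≠ 0 := by rintro rfl; exact hx₁ N₁.zero_mem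
  obtain ⟨e₁₁, e₁₂, e₂₁, e₂₂, hone, hA, hD, hE⟩ := hS.exists_unimodular K x y (Or.inl hx0)
  have mem_cancel : ∀ {N : Ideal S}, N.IsMaximal → ∀ {a b : S}, a * b ∈ N → b ∉ N → a ∈ N :=
    fun hN _ _ hab hb ↦ (hN.isPrime.mem_or_mem hab).resolve_right hb
  have hR₁ : ∀ r : R, algebraMap R S r ∈ N₁ ↔ r ∈ M := fun r ↦ by rw [← hM₁, Ideal.mem_comap]
  have hR₂ : ∀ r : R, algebraMap R S r ∈ N₂ ↔ r ∈ M := fun r ↦ by rw [← hM₂, Ideal.mem_comap]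
  have hR₃ : ∀ r : R, algebraMap R S r ∈ N₃ ↔ r ∈ M := fun r ↦ by rw [← hM₃, Ideal.mem_comap]
  -- Multipliers of `R x + R y` in `N₂` are in `N₁`.
  have key : ∀ e ∈ ({e₁₁, e₂₂} : Set S), e ∈ N₂ → e ∈ N₁ := by
    intro e he he₂
    obtain ⟨α, β, hαβ⟩ := hE e he x (by simp)
    obtain ⟨γ, δ, hγδ⟩ := hE e he y (by simp)
    have hβ : β ∈ M := by
      rw [← hR₂]
      refine mem_cancel h₂ (b := y) ?_ hy₂
      rw [eq_sub_of_add_eq' hαβ.symm]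
      exact sub_mem (N₂.mul_mem_right _ he₂) (N₂.mul_mem_left _ hx₂)
    have hδ : δ ∈ M := by
      rw [← hR₂]
      refine mem_cancel h₂ (b := y) ?_ hy₂
      rw [eq_sub_of_add_eq' hγδ.symm]
      exact sub_mem (N₂.mul_mem_right _ he₂) (N₂.mul_mem_left _ hx₂)
    have hγ : γ ∈ M := by
      rw [← hR₁]
      refine mem_cancel h₁ (b := x) ?_ hx₁
      rw [eq_sub_of_add_eq hγδ.symm]
      exact sub_mem (N₁.mul_mem_left _ hy₁) (N₁.mul_mem_left _ hy₁)
    have he₃ : e ∈ N₃ := by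
      refine mem_cancel h₃ (b := y) ?_ hy₃
      rw [hγδ]
      exact add_mem (N₃.mul_mem_right _ ((hR₃ _).2 hγ)) (N₃.mul_mem_right _ ((hR₃ _).2 hδ))
    have hα : α ∈ M := by
      rw [← hR₃]
      refine mem_cancel h₃ (b := x) ?_ hx₃
      rw [eq_sub_of_add_eq hαβ.symm]
      exact sub_mem (N₃.mul_mem_right _ he₃) (N₃.mul_mem_right _ ((hR₃ _).2 hβ))
    refine mem_cancel h₁ (b := x) ?_ hx₁
    rw [hαβ]
    exact add_mem (N₁.mul_mem_right _ ((hR₁ _).2 hα)) (N₁.mul_mem_left _ hy₁)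
  have hA₂ : e₁₁ ∈ N₂ := mem_cancel h₂ (hA ▸ N₂.mul_mem_left _ hx₂) hy₂
  have hD₁ : e₂₂ ∈ N₁ := mem_cancel h₁ (hD ▸ N₁.mul_mem_left _ hy₁) hx₁
  exact h₁.ne_top ((Ideal.eq_top_iff_one _).2 (hone ▸ add_mem (key _ (by simp) hA₂) hD₁))

theorem IsFinitelyStable.finite_maximal_over (K : Type*) [Field K] [Algebra R K]
    [IsFractionRing R K] [Algebra S K] [IsScalarTower R S K] [IsIntegralClosure S R K]
    (hS : IsFinitelyStable R) (M : Ideal R) :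
    {N : Ideal S | N.IsMaximal ∧ N.comap (algebraMap R S) = M}.Finite := by
  by_contra h
  obtain ⟨t, ht, hcard⟩ := Set.Infinite.exists_subset_card_eq h 3
  obtain ⟨N₁, N₂, N₃, h₁₂, h₁₃, h₂₃, rfl⟩ := Finset.card_eq_three.1 hcard
  obtain ⟨h₁, hM₁⟩ := ht (show N₁ ∈ _ by simp)
  obtain ⟨h₂, hM₂⟩ := ht (show N₂ ∈ _ by simp)
  obtain ⟨h₃, hM₃⟩ := ht (show N₃ ∈ _ by simp)
  exact h₂₃ (hS.not_three_maximal_over K h₁ h₂ h₃ hM₁ hM₂ hM₃ h₁₂ h₁₃)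

end IntegralClosure

/-! ### Primes of height one -/

theorem Ideal.IsPrime.eq_of_le_of_height_eq_one {S : Type*} [CommRing S] [IsDomain S]
    {P Q : Ideal S} (hP : P.IsPrime) (hP0 : P ≠ ⊥) (hQ : Q.IsPrime) (hQ1 : Q.height = 1)
    (hPQ : P ≤ Q) : P = Q := by
  by_contra hne
  have h := (Ideal.height_le_iff (p := Q) (n := 1)).1 hQ1.le P hP (lt_of_le_of_ne hPQ hne)
  exact hP0 (Ideal.height_eq_zero_iff_eq_bot.1 (by simpa using h))

/-- Otherwise `a` lies in every nonzero prime contained in `N`, so a minimal prime over `a` inside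
`N` has no smaller nonzero prime and is a prime of height one containing `a`. -/
theorem Ideal.exists_isPrime_le_notMem {S : Type*} [CommRing S] [IsDomain S] {a : S} (ha0 : a ≠ 0)
    (ha : ∀ Q : Ideal S, Q.IsPrime → Q.height = 1 → a ∉ Q) {N : Ideal S} [N.IsPrime]
    (haN : a ∈ N) : ∃ Q : Ideal S, Q.IsPrime ∧ Q ≠ ⊥ ∧ Q ≤ N ∧ a ∉ Q := by
  by_contra! h
  obtain ⟨P, hP, hPN⟩ := Ideal.exists_minimalPrimes_le
    ((Ideal.span_singleton_le_iff_mem N).2 haN)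
  have hPp : P.IsPrime := hP.1.1
  have haP : a ∈ P := (Ideal.span_singleton_le_iff_mem P).1 hP.1.2
  have hP0 : P ≠ ⊥ := by rintro rfl; exact ha0 (by simpa using haP)
  refine ha P hPp (le_antisymm ((Ideal.height_le_iff (n := 1)).2 fun Q hQ hQP ↦ ?_) ?_) haP
  · have hQ0 : Q = ⊥ := by
      by_contra hQ0
      have haQ := h Q hQ hQ0 (hQP.le.trans hPN)
      exact hQP.not_ge (hP.2 ⟨hQ, (Ideal.span_singleton_le_iff_mem Q).2 haQ⟩ hQP.le)
    simp [hQ0]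
  · rw [Order.one_le_iff_ne_zero]
    exact fun h ↦ hP0 (Ideal.height_eq_zero_iff_eq_bot.1 h)

/-- A one-dimensional local domain is Archimedean. Here the localization at `Q` is expressed by
denominators outside `Q`. -/
theorem Ideal.eq_zero_of_forall_pow_dvd_mul {S : Type*} [CommRing S] [IsDomain S] {Q : Ideal S}
    (hQ : Q.IsPrime) (hQ1 : Q.height = 1) {a b : S} (ha : a ∈ Q)
    (hb : ∀ n : ℕ, ∃ s ∉ Q, a ^ n ∣ s * b) : b = 0 := by
  by_contra hb0
  have ha0 : a ≠ 0 := by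
    rintro rfl
    obtain ⟨s, hs, h⟩ := hb 1
    rw [pow_one, zero_dvd_iff] at h
    exact hs ((mul_eq_zero.1 h).resolve_right hb0 ▸ Q.zero_mem)
  -- The only nonzero prime in `Q` contains `a`, so a power of `a` is a multiple of `b` locally.
  obtain ⟨n, s, hs, t, ht⟩ : ∃ (n : ℕ), ∃ s ∉ Q, b ∣ s * a ^ n := by
    by_contra! h
    have hdisj : Disjoint (Ideal.span {b} : Set S)
        (Q.primeCompl ⊔ Submonoid.powers a : Submonoid S) := by
      rw [Set.disjoint_left]
      intro z hz hz'
      obtain ⟨s, hs, -, ⟨n, rfl⟩, rfl⟩ := Submonoid.mem_sup.1 hz'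
      exact h n s hs (Ideal.mem_span_singleton.1 hz)
    obtain ⟨P, hP, hbP, hPd⟩ := Ideal.exists_le_prime_disjoint _ _ hdisj
    rw [Set.disjoint_left] at hPd
    have hPQ : P ≤ Q := by
      intro z hz
      by_contra hzQ
      exact hPd hz (Submonoid.mem_sup_left (show z ∈ Q.primeCompl from hzQ))
    have hP0 : P ≠ ⊥ := by
      rintro rfl
      exact hb0 (by simpa using hbP)
    have haP : a ∈ P := by rwa [hP.eq_of_le_of_height_eq_one hP0 hQ hQ1 hPQ]
    exact hPd haP (Submonoid.mem_sup_right (Submonoid.mem_powers a))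
  obtain ⟨s', hs', w, hw⟩ := hb (n + 1)
  have h : a ^ n * (s' * s) = a ^ n * (a * (w * t)) := by
    linear_combination s' * ht + t * hw
  have hmem : s' * s ∈ Q := by
    rw [mul_left_cancel₀ (pow_ne_zero n ha0) h]
    exact Q.mul_mem_right _ ha
  exact (hQ.mem_or_mem hmem).elim hs' hs

/-- In a Prüfer domain the primes in a given prime form a chain. -/
theorem Ideal.le_or_le_of_dvd_mul {S : Type*} [CommRing S] {N P Q : Ideal S} (hP : P.IsPrime)
    (hQ : Q.IsPrime) (hPN : P ≤ N) (hQN : Q ≤ N)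
    (hV : ∀ x y : S, ∃ s ∉ N, x ∣ s * y ∨ y ∣ s * x) : P ≤ Q ∨ Q ≤ P := by
  by_contra! h
  obtain ⟨x, hxP, hxQ⟩ := Set.not_subset.1 h.1
  obtain ⟨y, hyQ, hyP⟩ := Set.not_subset.1 h.2
  obtain ⟨s, hs, hxy | hxy⟩ := hV x y
  · exact (hP.mem_or_mem (P.mem_of_dvd hxy hxP)).elim (fun h ↦ hs (hPN h)) hyP
  · exact (hQ.mem_or_mem (Q.mem_of_dvd hxy hyQ)).elim (fun h ↦ hs (hQN h)) hxQ

/-- In a Prüfer domain `S` an element `x` is infinitely divisible by `a` if each maximal ideal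
containing `a` contains a prime containing `x` and not `a`. -/
theorem pow_dvd_of_forall_maximal {S : Type*} [CommRing S] {a x : S}
    (hV : ∀ N : Ideal S, N.IsMaximal → ∀ x y : S, ∃ s ∉ N, x ∣ s * y ∨ y ∣ s * x)
    (hx : ∀ N : Ideal S, N.IsMaximal → a ∈ N → ∃ Q : Ideal S, Q.IsPrime ∧ Q ≤ N ∧ a ∉ Q ∧ x ∈ Q)
    (n : ℕ) : a ^ n ∣ x := by
  -- the conductor of `x` into the ideal generated by `a ^ n`
  let C : Ideal S := Submodule.comap (LinearMap.mulRight S x) (Ideal.span {a ^ n})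
  have hC : ∀ s, s ∈ C ↔ a ^ n ∣ s * x := fun s ↦ by
    simp [C, Ideal.mem_span_singleton]
  have htop : C = ⊤ := by
    by_contra hne
    obtain ⟨N, hN, hCN⟩ := Ideal.exists_le_maximal C hne
    by_cases haN : a ∈ N
    · obtain ⟨Q, hQ, hQN, haQ, hxQ⟩ := hx N hN haN
      obtain ⟨s, hs, h | h⟩ := hV N hN (a ^ n) x
      · exact hs (hCN ((hC s).2 h))
      · refine (hQ.mem_or_mem (Q.mem_of_dvd h hxQ)).elim (fun h ↦ hs (hQN h)) fun h ↦ ?_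
        exact haQ (hQ.mem_of_pow_mem n h)
    · exact haN (hN.isPrime.mem_of_pow_mem n (hCN ((hC _).2 (dvd_mul_right _ _))))
  simpa using (hC 1).1 (htop ▸ Submodule.mem_top)

/-! ### Descent from the integral closure -/

/-- If `S` is a quadratic extension of `R`, elements of `R` divisible by `a` in `S` have squares
divisible by `a` in `R`: if `x = a z` and `z² = r z + s` then `x² = a (r x + a s)`. -/
theorem dvd_sq_of_algebraMap_dvd {R S : Type*} [CommRing R] [CommRing S] [Algebra R S]
    (hinj : Function.Injective (algebraMap R S))
    (hQ : ∀ z : S, ∃ r s : R, z ^ 2 = algebraMap R S r * z + algebraMap R S s) {a x : R}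
    (h : algebraMap R S a ∣ algebraMap R S x) : a ∣ x ^ 2 := by
  obtain ⟨z, hz⟩ := h
  obtain ⟨r, s, hrs⟩ := hQ z
  refine ⟨r * x + a * s, hinj ?_⟩
  simp only [map_pow, map_mul, map_add, hz]
  linear_combination (algebraMap R S a) ^ 2 * hrs

theorem IsArchimedeanDomain.eq_zero_of_forall_pow_dvd {R : Type*} [CommRing R] [IsDomain R]
    (hA : IsArchimedeanDomain R) {a x : R} (ha : ¬ IsUnit a) (h : ∀ n : ℕ, a ^ n ∣ x) : x = 0 := by
  have : x ∈ ⨅ n : ℕ, Ideal.span {a ^ n} := by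
    simpa [Ideal.mem_iInf, Ideal.mem_span_singleton] using h
  rwa [hA a ha] at this

/-- The Archimedean property of a localization, in terms of elements of the ring. -/
theorem isArchimedeanDomain_localization_of_forall {R : Type*} [CommRing R] [IsDomain R]
    (M : Ideal R) [M.IsPrime]
    (h : ∀ a ∈ M, ∀ b : R, (∀ n : ℕ, ∃ s ∉ M, a ^ n ∣ s * b) → b = 0) :
    IsArchimedeanDomain (Localization.AtPrime M) := by
  intro r hr
  rw [eq_bot_iff]
  intro y hy
  simp only [Submodule.mem_iInf, Ideal.mem_span_singleton] at hy
  have hinj := IsLocalization.injective (Localization.AtPrime M) M.primeCompl_le_nonZeroDivisors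
  obtain ⟨a, t, rfl⟩ := IsLocalization.exists_mk'_eq M.primeCompl r
  obtain ⟨b, u, rfl⟩ := IsLocalization.exists_mk'_eq M.primeCompl y
  have ha : a ∈ M := by
    by_contra ha
    exact hr ((IsLocalization.AtPrime.isUnit_mk'_iff (Localization.AtPrime M) M a t).2 ha)
  suffices hb : b = 0 by simp [hb]
  refine h a ha b fun n ↦ ?_
  obtain ⟨w, hw⟩ := hy n
  obtain ⟨c, v, rfl⟩ := IsLocalization.exists_mk'_eq M.primeCompl w
  rw [← IsLocalization.mk'_pow, ← IsLocalization.mk'_mul, IsLocalization.mk'_eq_iff_eq] at hw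
  refine ⟨_, (t ^ n * v).2, ?_⟩
  rw [hinj hw]
  exact ⟨u * c, by ring⟩

/-- An Archimedean domain `R` is locally Archimedean if it has an integral extension `S` that is a
Prüfer domain (`hV`), quadratic over `R` (`hQ`), with finitely many maximal ideals containing each
nonzero element of `R` (`hfin`) and finitely many primes of height one (`hone`). -/
theorem IsArchimedeanDomain.isLocallyArchimedean {R S : Type*} [CommRing R] [IsDomain R]
    [CommRing S] [IsDomain S] [Algebra R S] [Algebra.IsIntegral R S] [FaithfulSMul R S]
    (hA : IsArchimedeanDomain R)
    (hV : ∀ N : Ideal S, N.IsMaximal → ∀ x y : S, ∃ s ∉ N, x ∣ s * y ∨ y ∣ s * x)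
    (hQ : ∀ z : S, ∃ r s : R, z ^ 2 = algebraMap R S r * z + algebraMap R S s)
    (hfin : ∀ a : R, a ≠ 0 → {N : Ideal S | N.IsMaximal ∧ algebraMap R S a ∈ N}.Finite)
    (hone : {Q : Ideal S | Q.IsPrime ∧ Q.height = 1}.Finite) : IsLocallyArchimedean R := by
  intro M hM
  have hinj : Function.Injective (algebraMap R S) := FaithfulSMul.algebraMap_injective R S
  refine isArchimedeanDomain_localization_of_forall M fun a ha b hb ↦ ?_
  by_contra hb0
  have ha0 : a ≠ 0 := by
    rintro rfl
    obtain ⟨s, hs, h⟩ := hb 1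
    rw [pow_one, zero_dvd_iff] at h
    exact hs ((mul_eq_zero.1 h).resolve_right hb0 ▸ M.zero_mem)
  have hM1 : ∀ Q : Ideal S, Q.IsPrime → Q.height = 1 → ¬ M ≤ Q.comap (algebraMap R S) := by
    intro Q hQ hQ1 hle
    have hMQ : M = Q.comap (algebraMap R S) := hM.eq_of_le (hQ.comap _).ne_top hle
    refine hb0 (hinj ?_)
    rw [map_zero]
    refine Ideal.eq_zero_of_forall_pow_dvd_mul hQ hQ1 (a := algebraMap R S a) (hle ha) fun n ↦ ?_
    obtain ⟨s, hs, h⟩ := hb n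
    refine ⟨algebraMap R S s, by rwa [hMQ] at hs, ?_⟩
    rw [← map_pow, ← map_mul]
    exact map_dvd _ h
  -- The zero ideal is among the primes to avoid, so that `c ≠ 0`.
  obtain ⟨c, hcM, hc⟩ : ∃ c ∈ M, ∀ Q ∈ insert (⊥ : Ideal S) {Q | Q.IsPrime ∧ Q.height = 1},
      c ∉ Q.comap (algebraMap R S) := by
    have := (Ideal.subset_union_prime_finite (hone.insert ⊥) (I := M)
      (f := fun Q ↦ Q.comap (algebraMap R S)) ⊥ ⊥ ?_).not.2 ?_
    · obtain ⟨c, hcM, hc⟩ := Set.not_subset.1 this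
      exact ⟨c, hcM, by simpa using hc⟩
    · rintro Q hQ hne -
      exact (hQ.resolve_left hne).1.comap _
    · rintro ⟨Q, rfl | hQ, hle⟩
      · exact ha0 (hinj (by simpa using hle ha))
      · exact hM1 Q hQ.1 hQ.2 hle
  have hc0 : algebraMap R S c ≠ 0 := by simpa using hc ⊥ (by simp)
  have hc1 : ∀ Q : Ideal S, Q.IsPrime → Q.height = 1 → algebraMap R S c ∉ Q :=
    fun Q hQ hQ1 ↦ hc Q (Or.inr ⟨hQ, hQ1⟩)
  have hex : ∀ N ∈ {N : Ideal S | N.IsMaximal ∧ algebraMap R S c ∈ N}, ∃ x : R, x ≠ 0 ∧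
      ∃ Q : Ideal S, Q.IsPrime ∧ Q ≤ N ∧ algebraMap R S c ∉ Q ∧ algebraMap R S x ∈ Q := by
    rintro N ⟨hN, hcN⟩
    obtain ⟨Q, hQ, hQ0, hQN, hcQ⟩ := Ideal.exists_isPrime_le_notMem hc0 hc1 hcN
    obtain ⟨y, hyQ, hy0⟩ := Submodule.exists_mem_ne_zero_of_ne_bot hQ0
    obtain ⟨x, hxQ, hx0⟩ := Submodule.exists_mem_ne_zero_of_ne_bot
      (Ideal.comap_ne_bot_of_integral_mem hy0 hyQ (Algebra.IsIntegral.isIntegral (R := R) y))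
    exact ⟨x, hx0, Q, hQ, hQN, hcQ, hxQ⟩
  choose! f hf0 hf using hex
  have hcfin := hfin c (fun h ↦ hc0 (by rw [h, map_zero]))
  set x := ∏ N ∈ hcfin.toFinset, f N
  have hx0 : x ≠ 0 := Finset.prod_ne_zero_iff.2 fun N hN ↦ hf0 N (hcfin.mem_toFinset.1 hN)
  refine hx0 (pow_eq_zero_iff two_ne_zero |>.1 (hA.eq_zero_of_forall_pow_dvd (a := c) (fun hu ↦
    hM.ne_top (M.eq_top_of_isUnit_mem hcM hu)) fun n ↦ dvd_sq_of_algebraMap_dvd hinj hQ ?_))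
  rw [map_pow]
  refine pow_dvd_of_forall_maximal hV (fun N hN hcN ↦ ?_) n
  obtain ⟨Q, hQ, hQN, hcQ, hxQ⟩ := hf N ⟨hN, hcN⟩
  refine ⟨Q, hQ, hQN, hcQ, Q.mem_of_dvd (map_dvd _ (Finset.dvd_prod_of_mem f ?_)) hxQ⟩
  exact hcfin.mem_toFinset.2 ⟨hN, hcN⟩

/-! ### Archimedean finitely stable domains are locally Archimedean -/

theorem mainTheorem8 (R : Type*) [CommRing R] [IsDomain R]
    (hA : IsArchimedeanDomain R) (hS : IsFinitelyStable R) :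
    (HasFiniteCharacter R → (heightOnePrimesOfIntegralClosure R).Finite →
      IsLocallyArchimedean R) ∧
    (IsSemilocal R → IsLocallyArchimedean R) := by
  set K := FractionRing R
  set S := integralClosure R K
  have hV : ∀ N : Ideal S, N.IsMaximal → ∀ x y : S, ∃ s ∉ N, x ∣ s * y ∨ y ∣ s * x :=
    fun N hN x y ↦ hS.exists_notMem_dvd_mul K N x y
  have hC : ∀ P : Set (Ideal R), P.Finite →
      {N : Ideal S | N.IsMaximal ∧ N.comap (algebraMap R S) ∈ P}.Finite := by
    intro P hP
    refine (hP.biUnion fun M _ ↦ hS.finite_maximal_over K (S := S) M).subset ?_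
    rintro N ⟨hN, hNP⟩
    exact Set.mem_biUnion hNP ⟨hN, rfl⟩
  have main : HasFiniteCharacter R → (heightOnePrimesOfIntegralClosure R).Finite →
      IsLocallyArchimedean R := by
    refine fun hF ↦ hA.isLocallyArchimedean hV (hS.exists_sq_eq K) fun a ha ↦ ?_
    refine (hC _ (hF a ha)).subset ?_
    rintro N ⟨hN, haN⟩
    exact ⟨hN, Ideal.isMaximal_comap_of_isIntegral_of_isMaximal N, haN⟩
  refine ⟨main, fun hL ↦ main (fun r _ ↦ hL.subset fun M hM ↦ hM.1) ?_⟩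
  have hmax : {N : Ideal S | N.IsMaximal}.Finite := (hC _ hL).subset fun N hN ↦
    ⟨hN, @Ideal.isMaximal_comap_of_isIntegral_of_isMaximal _ _ _ _ _ _ N hN⟩
  -- Each maximal ideal contains at most one prime of height one.
  refine (hmax.biUnion (t := fun N ↦ {Q : Ideal S | (Q.IsPrime ∧ Q.height = 1) ∧ Q ≤ N})
    fun N hN ↦ Set.Subsingleton.finite ?_).subset ?_
  · rintro P ⟨⟨hP, hP1⟩, hPN⟩ Q ⟨⟨hQ, hQ1⟩, hQN⟩
    rcases Ideal.le_or_le_of_dvd_mul hP hQ hPN hQN (hV N hN) with h | h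
    · exact hP.eq_of_le_of_height_eq_one (Ideal.ne_bot_of_height_eq_one hP1) hQ hQ1 h
    · exact (hQ.eq_of_le_of_height_eq_one (Ideal.ne_bot_of_height_eq_one hQ1) hP hP1 h).symm
  · rintro Q ⟨hQ, hQ1⟩
    obtain ⟨N, hN, hQN⟩ := Ideal.exists_le_maximal Q hQ.ne_top
    exact Set.mem_biUnion hN ⟨⟨hQ, hQ1⟩, hQN⟩
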